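/- Let $G$ be a finite simple graph with at least one edge and maximum degree $\Delta$, and suppose that $G$ is chordless, i.e. every cycle of $G$ is an induced subgraph of $G$. A strong edge coloring of $G$ is a coloring of the edges in which every color class is an induced matching, i.e. any two vertices that belong to distinct edges of the same color are distinct and not adjacent in $G$. Let $\chi'_s(G)$ be the least number of colors in a strong edge coloring of $G$, and let $\mathrm{ch}'_s(G)$ be the least $n$ such that, whenever every edge $e$ of $G$ is assigned a list $L(e)$ of at least $n$ colors, there is a strong edge coloring of $G$ in which every edge $e$ receives a color from $L(e)$. Then $$\chi'_s(G)\le 4\Delta-3 \qquad\text{and}\qquad \mathrm{ch}'_s(G)\le 4\Delta-3 .$$ -/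

import Mathlib

namespace SimpleGraph

/-- A graph is chordless if each of its cycles, viewed as a subgraph, is an induced subgraph. -/
def IsChordlessGraph {V : Type*} (G : SimpleGraph V) : Prop :=
  ∀ (v : V) (p : G.Walk v v), p.IsCycle → p.toSubgraph.IsInduced

/-- A set `M` of edges of `G` is an induced matching if any two vertices that belong to distinct
edges of `M` are distinct and not adjacent in `G`. -/
def IsInducedMatching {V : Type*} (G : SimpleGraph V) (M : Set G.edgeSet) : Prop :=
  ∀ e ∈ M, ∀ f ∈ M, e ≠ f → ∀ u ∈ (e : Sym2 V), ∀ v ∈ (f : Sym2 V), u ≠ v ∧ ¬ G.Adj u v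

/-- An edge coloring is strong if every color class is an induced matching. -/
def IsStrongEdgeColoring {V α : Type*} (G : SimpleGraph V) (c : G.edgeSet → α) : Prop :=
  ∀ a : α, G.IsInducedMatching {e | c e = a}

/-- `G` has a strong edge coloring with (at most) `n` colors. -/
def StrongEdgeColorable {V : Type*} (G : SimpleGraph V) (n : ℕ) : Prop :=
  ∃ c : G.edgeSet → Fin n, G.IsStrongEdgeColoring c

/-- The strong chromatic index: the least number of colors in a strong edge coloring
(`⊤` if no finite number of colors is enough). -/
noncomputable def strongChromaticIndex {V : Type*} (G : SimpleGraph V) : ℕ∞ :=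
  ⨅ n ∈ {n : ℕ | G.StrongEdgeColorable n}, (n : ℕ∞)

/-- `G` is strongly `n`-edge-choosable: for every assignment of finite lists of at least `n`
colors to the edges there is a strong edge coloring that gives each edge a color from its list. -/
def StrongEdgeChoosable {V : Type*} (G : SimpleGraph V) (n : ℕ) : Prop :=
  ∀ L : G.edgeSet → Finset ℕ, (∀ e, n ≤ (L e).card) →
    ∃ c : G.edgeSet → ℕ, G.IsStrongEdgeColoring c ∧ ∀ e, c e ∈ L e

/-- The list strong chromatic index: the least `n` such that `G` is strongly `n`-edge-choosable
(`⊤` if there is none). -/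
noncomputable def listStrongChromaticIndex {V : Type*} (G : SimpleGraph V) : ℕ∞ :=
  ⨅ n ∈ {n : ℕ | G.StrongEdgeChoosable n}, (n : ℕ∞)

end SimpleGraph

/-! Everything follows from list choosability, since equal lists give an ordinary coloring. Put n =
Δ. Edges are colored greedily: induction on subgraphs H ≤ G peels off edges that conflict with at
most 4n - 4 edges of H. Conflicts are measured in G although degrees drop in H, so the induction
carries the invariant `hinv`: the ends of an edge of G outside H have H-degrees of product at most
1, hence one is isolated in H or both are leaves. Such edges of G then create few conflicts.

The edges to peel come from `exists_reducible_edge`, which rests on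
`exists_card_neighborFinset_filter_le_one`, proved by descent. If every non-isolated vertex had two
neighbors of degree at least 3, then a nontrivial set D attached to the rest only at c would contain
a cycle of such high-degree vertices. Walks outside this cycle cannot join consecutive cycle
vertices, nor cross when they start at consecutive ones. An innermost walk therefore exposes a cycle
vertex c' whose off-cycle part meets the cycle nowhere else. It can be chosen to avoid c, and a
third neighbor of c' lies off the induced cycle, so this part is a smaller nontrivial D. -/

namespace SimpleGraph

/-! ### Chordless graphs and detours around an edge -/

variable {V : Type*} {G : SimpleGraph V}

theorem IsChordlessGraph.mem_edges (hG : G.IsChordlessGraph) {v : V} {p : G.Walk v v}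
    (hp : p.IsCycle) {x y : V} (hx : x ∈ p.support) (hy : y ∈ p.support) (h : G.Adj x y) :
    s(x, y) ∈ p.edges := by
  have := hG v p hp ((p.mem_verts_toSubgraph).2 hx) ((p.mem_verts_toSubgraph).2 hy) h
  rwa [← Walk.mem_edges_toSubgraph, Subgraph.mem_edgeSet]

theorem IsChordlessGraph.mono {H : SimpleGraph V} (hG : G.IsChordlessGraph) (h : H ≤ G) :
    H.IsChordlessGraph := by
  intro v p hp x hx y hy hxy
  have hq : (p.mapLe h).IsCycle := (Walk.isCycle_mapLe h).2 hp
  rw [Walk.mem_verts_toSubgraph] at hx hy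
  have := hG.mem_edges hq (x := x) (y := y) (by simpa using hx) (by simpa using hy) (h hxy)
  rw [← Subgraph.mem_edgeSet, Walk.mem_edges_toSubgraph]
  simpa using this

/-- `s` and `t` are joined by a walk of `G` all of whose vertices lie in `S`. -/
def ReachableWithin (G : SimpleGraph V) (S : Set V) (s t : V) : Prop :=
  ∃ p : G.Walk s t, ∀ v ∈ p.support, v ∈ S

namespace ReachableWithin

variable {S S' : Set V} {s t u : V}

theorem refl (hs : s ∈ S) : G.ReachableWithin S s s :=
  ⟨Walk.nil, by simpa using hs⟩

theorem symm : G.ReachableWithin S s t → G.ReachableWithin S t s := fun ⟨p, hp⟩ =>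
  ⟨p.reverse, by simpa using hp⟩

theorem trans : G.ReachableWithin S s t → G.ReachableWithin S t u → G.ReachableWithin S s u :=
  fun ⟨p, hp⟩ ⟨q, hq⟩ => ⟨p.append q, fun v hv => by
    rw [Walk.mem_support_append_iff] at hv
    exact hv.elim (hp v) (hq v)⟩

theorem mono (h : S ⊆ S') : G.ReachableWithin S s t → G.ReachableWithin S' s t :=
  fun ⟨p, hp⟩ => ⟨p, fun v hv => h (hp v hv)⟩

theorem of_adj (h : G.Adj s t) (hs : s ∈ S) (ht : t ∈ S) : G.ReachableWithin S s t :=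
  ⟨h.toWalk, by simp [hs, ht]⟩

theorem mem_left : G.ReachableWithin S s t → s ∈ S := fun ⟨p, hp⟩ => hp _ p.start_mem_support

theorem mem_right : G.ReachableWithin S s t → t ∈ S := fun ⟨p, hp⟩ => hp _ p.end_mem_support

/-- The vertices of a walk within `S` are themselves reachable within `S`. -/
theorem to_component (h : G.ReachableWithin S s t) :
    G.ReachableWithin {z | G.ReachableWithin S s z} s t := by
  classical
  obtain ⟨p, hp⟩ := h
  exact ⟨p, fun v hv => ⟨p.takeUntil v hv, fun w hw =>
    hp w (p.support_takeUntil_subset_support hv hw)⟩⟩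

end ReachableWithin

/-- `x` and `y` are joined by a walk with at least one inner vertex whose inner vertices
lie in `A`. -/
def LinkedVia (G : SimpleGraph V) (A : Set V) (x y : V) : Prop :=
  ∃ s t, G.Adj x s ∧ G.ReachableWithin A s t ∧ G.Adj t y

namespace LinkedVia

variable {A B : Set V} {x y : V}

theorem symm : G.LinkedVia A x y → G.LinkedVia A y x := fun ⟨s, t, hs, h, ht⟩ =>
  ⟨t, s, ht.symm, h.symm, hs.symm⟩

theorem exists_isPath (h : G.LinkedVia A x y) (hxy : x ≠ y) (hx : x ∉ A) (hy : y ∉ A) :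
    ∃ p : G.Walk x y, p.IsPath ∧ 1 < p.length ∧ ∀ v ∈ p.support, v = x ∨ v = y ∨ v ∈ A := by
  classical
  obtain ⟨s, t, hs, ⟨q, hq⟩, ht⟩ := h
  have hb : ∀ v ∈ q.bypass.support, v ∈ A := fun v hv =>
    hq v (q.support_bypass_subset_support hv)
  refine ⟨Walk.cons hs (q.bypass.concat ht), ?_, by simp, ?_⟩
  · rw [Walk.cons_isPath_iff]
    refine ⟨(q.bypass_isPath).concat (fun h => hy (hb _ h)) ht, ?_⟩
    rw [Walk.support_concat]
    simp only [List.mem_append, List.mem_singleton, not_or]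
    exact ⟨fun h => hx (hb _ h), hxy⟩
  · intro v hv
    rw [Walk.support_cons, Walk.support_concat] at hv
    simp only [List.mem_cons, List.mem_append, List.not_mem_nil,
      or_false] at hv
    rcases hv with h | h | h
    · exact .inl h
    · exact .inr (.inr (hb _ h))
    · exact .inr (.inl h)

end LinkedVia

/-- In a chordless graph, the ends of an edge are not linked by two disjoint detours. -/
theorem IsChordlessGraph.not_linkedVia (hG : G.IsChordlessGraph) {x y : V} (hxy : G.Adj x y)
    {A B : Set V} (hA : G.LinkedVia A x y) (hB : G.LinkedVia B x y) (hxA : x ∉ A) (hyA : y ∉ A)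
    (hxB : x ∉ B) (hyB : y ∉ B) (hAB : Disjoint A B) : False := by
  obtain ⟨p, hp, hpl, hps⟩ := hA.exists_isPath hxy.ne hxA hyA
  obtain ⟨q, hq, hql, hqs⟩ := hB.symm.exists_isPath hxy.ne' hyB hxB
  -- Both detours are paths of length greater than 1, so neither uses the edge `xy`, which is then a
  -- chord of their union.
  have hc : (p.append q).IsCycle := by
    refine hp.isCycle_append hq (fun z hz hz' => ?_) (.inl hpl)
    have h1 := hp.support_nodup
    have h2 := hq.support_nodup
    rw [← Walk.cons_tail_support, List.nodup_cons] at h1 h2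
    have hzx : z ≠ x := fun h => h1.1 (h ▸ hz)
    have hzy : z ≠ y := fun h => h2.1 (h ▸ hz')
    have hzA := hps z (List.mem_of_mem_tail hz)
    have hzB := hqs z (List.mem_of_mem_tail hz')
    exact Set.disjoint_left.1 hAB (by tauto) (by tauto : z ∈ B)
  have := hG.mem_edges hc (x := x) (y := y) (by simp) (by simp) hxy
  rw [Walk.edges_append, List.mem_append] at this
  rcases this with h | h
  · have := hp.length_eq_one_of_mem_edges h
    omega
  · rw [Sym2.eq_swap] at h
    have := hq.length_eq_one_of_mem_edges h
    omega

/-- Consecutive values of a map `f : ℕ → V` form a walk. -/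
theorem reachableWithin_of_forall_adj {f : ℕ → V} (hf : ∀ i, G.Adj (f i) (f (i + 1)))
    {a b : ℕ} (hab : a ≤ b) : G.ReachableWithin {z | ∃ i, a ≤ i ∧ i ≤ b ∧ f i = z} (f a) (f b) := by
  induction b, hab using Nat.le_induction with
  | base => exact .refl ⟨a, le_rfl, le_rfl, rfl⟩
  | succ b hab ih =>
    refine (ih.mono ?_).trans (.of_adj (hf b) ⟨b, hab, by omega, rfl⟩
      ⟨b + 1, by omega, le_rfl, rfl⟩)
    rintro z ⟨i, h1, h2, h3⟩
    exact ⟨i, h1, by omega, h3⟩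

/-! ### Walks outside a cycle of a chordless graph -/

section PeriodicCycle

/- A cycle of length `m` is described by an `m`-periodic map `f` with vertex set `C`. -/
variable {f : ℕ → V} {m : ℕ} {C : Set V}

/-- The rest of the cycle is already one detour around this edge; a link outside the cycle would be
a second, disjoint one. -/
theorem IsChordlessGraph.not_linkedVia_succ (hG : G.IsChordlessGraph) (hm : 3 ≤ m)
    (hf : ∀ i, G.Adj (f i) (f (i + 1))) (hinj : ∀ i j, f i = f j ↔ i % m = j % m)
    (hC : ∀ i, f i ∈ C) (a : ℕ) : ¬ G.LinkedVia Cᶜ (f a) (f (a + 1)) := by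
  intro h
  have hne : ∀ i j, i < j → j < i + m → f i ≠ f j := by
    intro i j h1 h2 h3
    have := (Nat.modEq_iff_dvd' h1.le).1 ((hinj i j).1 h3)
    exact absurd (Nat.le_of_dvd (by omega) this) (by omega)
  have hper : f (a + m) = f a := (hinj _ _).2 (by simp)
  refine hG.not_linkedVia (hf a) h
    (B := {z | ∃ i, a + 2 ≤ i ∧ i ≤ a + m - 1 ∧ f i = z}) ?_ (fun h => h (hC _))
    (fun h => h (hC _)) ?_ ?_ ?_
  · refine LinkedVia.symm ⟨f (a + 2), f (a + m - 1), hf (a + 1),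
      reachableWithin_of_forall_adj hf (by omega), ?_⟩
    have := hf (a + m - 1)
    rwa [show a + m - 1 + 1 = a + m by omega, hper] at this
  · rintro ⟨i, h1, h2, h3⟩
    exact hne a i (by omega) (by omega) h3.symm
  · rintro ⟨i, h1, h2, h3⟩
    exact hne (a + 1) i (by omega) (by omega) h3.symm
  · rw [Set.disjoint_left]
    rintro z hz ⟨i, -, -, rfl⟩
    exact hz (hC i)

/-- The edge from `f a` to `f (a + 1)` would have two disjoint detours: through the first link to `f
b` and back along the cycle to `f (a + 1)`, and through the second link to `f d` and on along the
cycle to `f a`. -/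
theorem IsChordlessGraph.not_linkedVia_crossing (hG : G.IsChordlessGraph) (hm : 3 ≤ m)
    (hf : ∀ i, G.Adj (f i) (f (i + 1))) (hinj : ∀ i j, f i = f j ↔ i % m = j % m)
    (hC : ∀ i, f i ∈ C) {a b d : ℕ} (hab : a + 1 < b) (hbd : b < d) (hda : d < a + m)
    (h₁ : G.LinkedVia Cᶜ (f a) (f b)) (h₂ : G.LinkedVia Cᶜ (f (a + 1)) (f d)) : False := by
  have hne : ∀ i j, i < j → j < i + m → f i ≠ f j := by
    intro i j h1 h2 h3
    have := (Nat.modEq_iff_dvd' h1.le).1 ((hinj i j).1 h3)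
    exact absurd (Nat.le_of_dvd (by omega) this) (by omega)
  have hper : f (a + m) = f a := (hinj _ _).2 (by simp)
  obtain ⟨s₁, t₁, hs₁, hr₁, ht₁⟩ := h₁
  obtain ⟨s₂, t₂, hs₂, hr₂, ht₂⟩ := h₂
  let D₁ : Set V := {z | G.ReachableWithin Cᶜ s₁ z}
  let D₂ : Set V := {z | G.ReachableWithin Cᶜ s₂ z}
  have hD : Disjoint D₁ D₂ := by
    rw [Set.disjoint_left]
    intro z h1 h2
    exact hG.not_linkedVia_succ hm hf hinj hC a ⟨s₁, s₂, hs₁, h1.trans h2.symm, hs₂.symm⟩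
  have hfD₁ : ∀ i, f i ∉ D₁ := fun i h => h.mem_right (hC i)
  have hfD₂ : ∀ i, f i ∉ D₂ := fun i h => h.mem_right (hC i)
  let I : Set V := {z | ∃ i, a + 2 ≤ i ∧ i ≤ b ∧ f i = z}
  let J : Set V := {z | ∃ i, d ≤ i ∧ i ≤ a + m - 1 ∧ f i = z}
  have hI : G.ReachableWithin I (f (a + 2)) (f b) :=
    reachableWithin_of_forall_adj hf (by omega)
  have hJ : G.ReachableWithin J (f d) (f (a + m - 1)) :=
    reachableWithin_of_forall_adj hf (by omega)
  refine hG.not_linkedVia (hf a) (A := D₁ ∪ I) (B := D₂ ∪ J) ?_ ?_ ?_ ?_ ?_ ?_ ?_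
  · refine ⟨s₁, f (a + 2), hs₁, ?_, (hf (a + 1)).symm⟩
    refine (hr₁.to_component.mono Set.subset_union_left).trans (.trans (.of_adj ht₁ ?_ ?_)
      (hI.symm.mono Set.subset_union_right))
    · exact .inl hr₁
    · exact .inr hI.mem_right
  · refine LinkedVia.symm ⟨s₂, f (a + m - 1), hs₂, ?_, ?_⟩
    · refine (hr₂.to_component.mono Set.subset_union_left).trans (.trans (.of_adj ht₂ ?_ ?_)
        (hJ.mono Set.subset_union_right))
      · exact .inl hr₂
      · exact .inr hJ.mem_left
    · have := hf (a + m - 1)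
      rwa [show a + m - 1 + 1 = a + m by omega, hper] at this
  · rintro (h | ⟨i, h1, h2, h3⟩)
    · exact hfD₁ _ h
    · exact hne a i (by omega) (by omega) h3.symm
  · rintro (h | ⟨i, h1, h2, h3⟩)
    · exact hfD₁ _ h
    · exact hne (a + 1) i (by omega) (by omega) h3.symm
  · rintro (h | ⟨i, h1, h2, h3⟩)
    · exact hfD₂ _ h
    · exact hne a i (by omega) (by omega) h3.symm
  · rintro (h | ⟨i, h1, h2, h3⟩)
    · exact hfD₂ _ h
    · exact hne (a + 1) i (by omega) (by omega) h3.symm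
  · rw [Set.disjoint_left]
    rintro z (hz | ⟨i, h1, h2, rfl⟩) (hz' | ⟨j, h3, h4, h5⟩)
    · exact Set.disjoint_left.1 hD hz hz'
    · exact hfD₁ j (h5 ▸ hz)
    · exact hfD₂ i hz'
    · exact hne i j (by omega) (by omega) h5.symm

/-- Away from any given vertex, a cycle of a chordless graph has a vertex that is not joined to
another vertex of the cycle by a walk outside of the cycle. -/
theorem IsChordlessGraph.exists_not_linkedVia (hG : G.IsChordlessGraph) (hm : 3 ≤ m)
    (hf : ∀ i, G.Adj (f i) (f (i + 1))) (hinj : ∀ i j, f i = f j ↔ i % m = j % m)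
    (hC : ∀ i, f i ∈ C) :
    ∃ c, f c ≠ f 0 ∧ ∀ j, f j ≠ f c → ¬ G.LinkedVia Cᶜ (f c) (f j) := by
  classical
  have hper : ∀ i, f (i + m) = f i := fun i => (hinj _ _).2 (by simp)
  -- Take a link of least span. The full turn from 0 to `m` serves as a default when there are no
  -- links.
  let P : ℕ → Prop := fun n => ∃ a b, a < b ∧ b ≤ m ∧ b - a = n ∧
    ((a = 0 ∧ b = m) ∨ G.LinkedVia Cᶜ (f a) (f b))
  have hP : ∃ n, P n := ⟨m, 0, m, by omega, le_rfl, by omega, .inl ⟨rfl, rfl⟩⟩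
  obtain ⟨a, b, hab, hbm, hn, hl⟩ := Nat.find_spec hP
  have hmin : ∀ a' b', a' < b' → b' ≤ m → b' - a' < b - a → ¬ G.LinkedVia Cᶜ (f a') (f b') :=
    fun a' b' h1 h2 h3 h4 => Nat.find_min hP (hn ▸ h3) ⟨a', b', h1, h2, rfl, .inr h4⟩
  have hab' : a + 1 < b := by
    rcases Nat.lt_or_ge (a + 1) b with h | h
    · exact h
    · obtain rfl : b = a + 1 := by omega
      rcases hl with h | h
      · omega
      · exact absurd h (hG.not_linkedVia_succ hm hf hinj hC a)
  -- A link from `a + 1` would join consecutive vertices, cross the minimal link, or have smaller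
  -- span.
  refine ⟨a + 1, fun h => ?_, fun j hj hlj => ?_⟩
  · rw [hinj, Nat.mod_eq_of_lt (by omega)] at h
    simp at h
  · have hjm : f (j % m) = f j := (hinj _ _).2 (by simp)
    have hjlt : j % m < m := Nat.mod_lt _ (by omega)
    rw [← hjm] at hj hlj
    generalize j % m = k at *
    rcases lt_trichotomy k (a + 1) with hk | hk | hk
    · rcases Nat.lt_or_ge k a with hka | hka
      · have hl' : G.LinkedVia Cᶜ (f a) (f b) := hl.resolve_left (by omega)
        rw [← hper k] at hlj
        rcases Nat.lt_or_ge b (k + m) with hb | hb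
        · exact hG.not_linkedVia_crossing hm hf hinj hC hab' hb (by omega) hl' hlj
        -- Here `k + m ≤ b ≤ m` forces `k = 0` and `b = m`.
        · have : k + m = m := by omega
          rw [this] at hlj
          exact hmin (a + 1) m (by omega) le_rfl (by omega) hlj
      · obtain rfl : k = a := by omega
        exact hG.not_linkedVia_succ hm hf hinj hC k hlj.symm
    · exact hj (by rw [hk])
    · rcases Nat.lt_or_ge b k with hkb | hkb
      · exact hG.not_linkedVia_crossing hm hf hinj hC hab' hkb (by omega)
          (hl.resolve_left (by omega)) hlj
      · exact hmin (a + 1) k hk (by omega) (by omega) hlj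

end PeriodicCycle

theorem IsChordlessGraph.exists_not_linkedVia_support (hG : G.IsChordlessGraph) {v : V}
    {p : G.Walk v v} (hp : p.IsCycle) :
    ∃ c ∈ p.support, c ≠ v ∧
      ∀ d ∈ p.support, d ≠ c → ¬ G.LinkedVia {x | x ∈ p.support}ᶜ c d := by
  have hm := hp.three_le_length
  have hlt : ∀ i, i % p.length < p.length := fun i => Nat.mod_lt _ (by omega)
  have hadj : ∀ i, G.Adj (p.getVert (i % p.length)) (p.getVert ((i + 1) % p.length)) := by
    intro i
    have h1 := p.adj_getVert_succ (hlt i)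
    rcases Nat.lt_or_ge (i % p.length + 1) p.length with h | h
    · have : (i + 1) % p.length = i % p.length + 1 := by
        rw [Nat.add_mod, Nat.mod_eq_of_lt (by omega : 1 < p.length), Nat.mod_eq_of_lt h]
      simpa only [this] using h1
    · have h' : i % p.length + 1 = p.length := by have := hlt i; omega
      have : (i + 1) % p.length = 0 := by
        rw [Nat.add_mod, Nat.mod_eq_of_lt (by omega : 1 < p.length), h', Nat.mod_self]
      rw [h', p.getVert_length] at h1
      simpa only [this, p.getVert_zero] using h1
  have hinj : ∀ i j, p.getVert (i % p.length) = p.getVert (j % p.length) ↔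
      i % p.length = j % p.length := by
    intro i j
    refine ⟨fun h => hp.getVert_injOn' ?_ ?_ h, fun h => by simp only [h]⟩ <;>
    · have h1 := hlt i
      have h2 := hlt j
      simp only [Set.mem_ofPred_eq]; omega
  obtain ⟨c, hc, h⟩ := hG.exists_not_linkedVia (f := fun i => p.getVert (i % p.length))
    (C := {x | x ∈ p.support}) hm hadj hinj
    (fun i => p.getVert_mem_support _)
  refine ⟨_, p.getVert_mem_support (c % p.length), ?_, ?_⟩
  · simpa using hc
  · intro d hd hdc
    obtain ⟨n, rfl, hn⟩ := Walk.mem_support_iff_exists_getVert.1 hd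
    have : p.getVert (n % p.length) = p.getVert n := by
      rcases hn.lt_or_eq with h | h
      · rw [Nat.mod_eq_of_lt h]
      · simp [h]
    rw [← this] at hdc ⊢
    exact h n hdc

theorem ReachableWithin.exists_adj_of_insert {S : Set V} {c z : V}
    (h : G.ReachableWithin (insert c S) c z) (hz : z ≠ c) :
    ∃ s, G.Adj c s ∧ G.ReachableWithin S s z := by
  classical
  obtain ⟨p, hp⟩ := h
  have hb := p.bypass_isPath
  have hs : ∀ v ∈ p.bypass.support, v ∈ insert c S := fun v hv =>
    hp v (p.support_bypass_subset_support hv)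
  generalize p.bypass = q at hb hs
  cases q with
  | nil => exact absurd rfl hz
  | cons h q =>
    rw [Walk.cons_isPath_iff] at hb
    refine ⟨_, h, q, fun v hv => ?_⟩
    have := hs v (by simp [hv])
    rcases this with rfl | h
    · exact absurd hv hb.2
    · exact h

/-- If some cycle vertex `z` reaches `r` off the cycle, take an unlinked vertex other than `z`: were
it to reach `r` too, it would be linked to `z`. -/
theorem IsChordlessGraph.exists_not_linkedVia_not_reachableWithin (hG : G.IsChordlessGraph) {v : V}
    {p : G.Walk v v} (hp : p.IsCycle) (r : V) :
    ∃ c ∈ p.support, (∀ d ∈ p.support, d ≠ c → ¬ G.LinkedVia {x | x ∈ p.support}ᶜ c d) ∧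
      ¬ G.ReachableWithin (insert c {x | x ∈ p.support}ᶜ) c r := by
  classical
  set S : Set V := {x | x ∈ p.support}ᶜ with hS
  by_cases h : ∃ z ∈ p.support, G.ReachableWithin (insert z S) z r
  · obtain ⟨z, hz, hr⟩ := h
    obtain ⟨c, hc, hcz, hl⟩ := hG.exists_not_linkedVia_support (hp.rotate hz)
    simp only [Walk.mem_support_rotate_iff] at hc hl
    refine ⟨c, hc, hl, fun hcr => ?_⟩
    by_cases hrc : r = c
    · subst hrc
      obtain ⟨s, -, hs⟩ := hr.exists_adj_of_insert hcz
      exact hs.mem_right hc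
    · obtain ⟨s, hs, hsr⟩ := hcr.exists_adj_of_insert hrc
      have hrz : r ≠ z := fun h => hsr.mem_right (h ▸ hz)
      obtain ⟨t, ht, htr⟩ := hr.exists_adj_of_insert hrz
      exact hl z hz hcz.symm ⟨s, t, hs, hsr.trans htr.symm, ht.symm⟩
  · obtain ⟨c, hc, -, hl⟩ := hG.exists_not_linkedVia_support hp
    exact ⟨c, hc, hl, fun hr => h ⟨c, hc, hr⟩⟩

/-- A finite graph with an edge in which no vertex other than `c` is a leaf contains a cycle. -/
theorem exists_isCycle_of_forall_ne [Finite V] {c a b : V} (hab : G.Adj a b)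
    (h : ∀ v w, v ≠ c → G.Adj v w → ∃ x, x ≠ w ∧ G.Adj v x) :
    ∃ (v : V) (p : G.Walk v v), p.IsCycle := by
  by_contra hcyc
  have hac : G.IsAcyclic := fun v p hp => hcyc ⟨v, p, hp⟩
  have : Nonempty V := ⟨a⟩
  obtain ⟨u, v, p, hp, hmax⟩ := Walk.exists_isPath_forall_isPath_length_le_length G
  -- In an acyclic graph a longest path starts at a leaf, so both of its ends would be `c`.
  have key : ∀ {u v : V} (p : G.Walk u v), p.IsPath → 1 ≤ p.length →
      (∀ (u' v' : V) (p' : G.Walk u' v'), p'.IsPath → p'.length ≤ p.length) → u = c := by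
    intro u v p hp hl hmax
    by_contra hu
    have hnn : ¬ p.Nil := by
      rw [← Walk.length_eq_zero_iff]; omega
    obtain ⟨x, hx, hux⟩ := h u p.snd hu (p.adj_snd hnn)
    by_cases hxs : x ∈ p.support
    · exact hx (hac.eq_snd_of_adj_start hp hux hxs)
    · have := hmax _ _ (Walk.cons hux.symm p) (hp.cons hxs)
      simp at this
  have hl : 1 ≤ p.length := by
    simpa using hmax a b hab.toWalk (by simp [Walk.isPath_def, hab.ne])
  have h1 := key p hp hl hmax
  have h2 := key p.reverse hp.reverse (by simpa using hl) (by simpa using hmax)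
  subst h1
  subst h2
  have := Walk.length_eq_zero_iff.2 (Walk.isPath_iff_nil.1 hp)
  omega

/-! ### Descent to a vertex with few neighbors of degree at least three -/

section Fintype

open scoped Classical Finset
variable [Fintype V]

/-- The step that confines a bad configuration to a smaller vertex set. -/
theorem IsChordlessGraph.exists_ssubset (hG : G.IsChordlessGraph)
    (hT : ∀ v w, G.Adj v w → 1 < #{x ∈ G.neighborFinset v | 3 ≤ G.degree x})
    {D : Set V} {c : V} (hc : c ∈ D) (hD : ∀ v ∈ D, v ≠ c → ∀ w, G.Adj v w → w ∈ D)
    (hne : ∃ w ∈ D, w ≠ c ∧ ∃ x, G.Adj w x) :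
    ∃ D' ⊂ D, ∃ c' ∈ D', (∀ v ∈ D', v ≠ c' → ∀ w, G.Adj v w → w ∈ D') ∧
      ∃ w ∈ D', w ≠ c' ∧ ∃ x, G.Adj w x := by
  let S : Set V := {v | v ∈ D ∧ 3 ≤ G.degree v}
  have hT' : ∀ v w, G.Adj v w → v ∈ D → v ≠ c → ∀ y, ∃ x, x ≠ y ∧ G.Adj v x ∧ x ∈ S := by
    intro v w hvw hv hvc y
    obtain ⟨x, hx, hxy⟩ := Finset.exists_mem_ne (hT v w hvw) y
    simp only [Finset.mem_filter, mem_neighborFinset] at hx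
    exact ⟨x, hxy, hx.1, hD v hv hvc x hx.1, hx.2⟩
  let H : SimpleGraph V :=
    { Adj := fun a b => G.Adj a b ∧ a ∈ S ∧ b ∈ S
      symm := ⟨fun a b h => ⟨h.1.symm, h.2.2, h.2.1⟩⟩
      loopless := ⟨fun a h => h.1.ne rfl⟩ }
  have hHG : H ≤ G := fun a b h => h.1
  obtain ⟨w, hw, hwc, x, hwx⟩ := hne
  obtain ⟨a, hac, hwa, haS⟩ := hT' w x hwx hw hwc c
  obtain ⟨b, -, hab, hbS⟩ := hT' a w hwa.symm haS.1 hac c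
  obtain ⟨v, p, hp⟩ := exists_isCycle_of_forall_ne (G := H) (c := c) (a := a) (b := b)
    ⟨hab, haS, hbS⟩ (fun v w hv hvw => by
      obtain ⟨x, hx, hvx, hxS⟩ := hT' v w hvw.1 hvw.2.1.1 hv w
      exact ⟨x, hx, hvx, hvw.2.1, hxS⟩)
  have hpS : ∀ z ∈ p.support, z ∈ S := by
    intro z hz
    obtain ⟨e, he, hze⟩ := (Walk.mem_support_iff_exists_mem_edges_of_not_nil hp.not_nil).1 hz
    induction e with
    | h s t =>
      have := p.adj_of_mem_edges he
      rcases Sym2.mem_iff.1 hze with rfl | rfl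
      · exact this.2.1
      · exact this.2.2
  have hq : (p.mapLe hHG).IsCycle := (Walk.isCycle_mapLe hHG).2 hp
  have hqS : ∀ z ∈ (p.mapLe hHG).support, z ∈ S := by simpa using hpS
  generalize p.mapLe hHG = q at hq hqS
  obtain ⟨c', hc', hl, hr⟩ := hG.exists_not_linkedVia_not_reachableWithin hq c
  let R : Set V := insert c' {x | x ∈ q.support}ᶜ
  have hcR : G.ReachableWithin R c' c' := .refl (.inl rfl)
  -- A walk in `R` from `c'` starts in `D` and never meets `c`, the only exit.
  have hsub : ∀ z, G.ReachableWithin R c' z → z ∈ D := by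
    rintro z ⟨p, hp⟩
    have : ∀ {y z : V} (p : G.Walk y z), (∀ v ∈ p.support, v ∈ R) → G.ReachableWithin R c' y →
        y ∈ D → z ∈ D := by
      intro y z p
      induction p with
      | nil => exact fun _ _ h => h
      | cons h p ih =>
        intro hp hy hyD
        refine ih (fun v hv => hp v (by simp [hv])) (hy.trans (.of_adj h hy.mem_right
          (hp _ (by simp)))) (hD _ hyD (fun h => hr (h ▸ hy)) _ h)
    exact this p hp hcR (hqS c' hc').1
  refine ⟨{z | G.ReachableWithin R c' z}, ⟨hsub, fun h => hr (h hc)⟩, c', hcR, ?_, ?_⟩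
  · intro v hv hvc w hvw
    by_cases hw : w ∈ R
    · exact hv.trans (.of_adj hvw hv.mem_right hw)
    · obtain ⟨s, hs, hsv⟩ := hv.exists_adj_of_insert hvc
      have hwq : w ∈ q.support := by
        by_contra h
        exact hw (.inr h)
      exact absurd ⟨s, v, hs, hsv, hvw⟩ (hl w hwq (fun h => hw (.inl h)))
  · have h3 : (q.toSubgraph.neighborSet c').ncard < (G.neighborSet c').ncard := by
      rw [hq.ncard_neighborSet_toSubgraph_eq_two hc', Set.ncard_eq_toFinset_card',
        ← neighborFinset_def, card_neighborFinset_eq_degree]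
      exact (hqS c' hc').2
    obtain ⟨w, hw, hwq⟩ := Set.exists_mem_notMem_of_ncard_lt_ncard h3
    have hws : w ∉ q.support := fun h => hwq (by
      rw [Subgraph.mem_neighborSet, ← Subgraph.mem_edgeSet, Walk.mem_edges_toSubgraph]
      exact hG.mem_edges hq hc' h hw)
    exact ⟨w, .of_adj hw (.inl rfl) (.inr hws), hw.ne', c', hw.symm⟩

/-- A chordless graph with an edge has a non-isolated vertex with at most one neighbor of degree
at least three. -/
theorem IsChordlessGraph.exists_card_neighborFinset_filter_le_one (hG : G.IsChordlessGraph)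
    {a b : V} (hab : G.Adj a b) :
    ∃ v w, G.Adj v w ∧ #{x ∈ G.neighborFinset v | 3 ≤ G.degree x} ≤ 1 := by
  by_contra! hT
  have key : ∀ (D : Set V) (c : V), c ∈ D → (∀ v ∈ D, v ≠ c → ∀ w, G.Adj v w → w ∈ D) →
      (∃ w ∈ D, w ≠ c ∧ ∃ x, G.Adj w x) → False := by
    intro D
    induction D using WellFoundedLT.induction with
    | ind D ih =>
      intro c hc hD hne
      obtain ⟨D', hlt, c', hc', hD', hne'⟩ := hG.exists_ssubset hT hc hD hne
      exact ih D' hlt c' hc' hD' hne'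
  exact key Set.univ a trivial (fun _ _ _ _ _ => trivial) ⟨b, trivial, hab.ne', a, hab.symm⟩

end Fintype

/-! ### Greedy list coloring -/

section ListColoring

open scoped Classical Finset

variable {H : SimpleGraph V}

/-- Two edges conflict if they share a vertex or are joined by an edge of `G`. -/
def EdgeConflict (G : SimpleGraph V) (e f : Sym2 V) : Prop :=
  ∃ u ∈ e, ∃ v ∈ f, u = v ∨ G.Adj u v

theorem EdgeConflict.symm {e f : Sym2 V} : G.EdgeConflict e f → G.EdgeConflict f e :=
  fun ⟨u, hu, v, hv, h⟩ => ⟨v, hv, u, hu, h.imp Eq.symm Adj.symm⟩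

/-- The edges in `S` can be colored from the lists `L` so that conflicting edges get distinct
colors. -/
def ListColorableOn (G : SimpleGraph V) (L : Sym2 V → Finset ℕ) (S : Finset (Sym2 V)) : Prop :=
  ∃ c : Sym2 V → ℕ, (∀ e ∈ S, c e ∈ L e) ∧
    ∀ e ∈ S, ∀ f ∈ S, e ≠ f → G.EdgeConflict e f → c e ≠ c f

theorem ListColorableOn.insert {L : Sym2 V → Finset ℕ} {S : Finset (Sym2 V)} {e : Sym2 V}
    (h : G.ListColorableOn L S) (he : #{f ∈ S | f ≠ e ∧ G.EdgeConflict e f} < #(L e)) :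
    G.ListColorableOn L (insert e S) := by
  by_cases heS : e ∈ S
  · rwa [Finset.insert_eq_of_mem heS]
  obtain ⟨c, hcL, hc⟩ := h
  obtain ⟨a, haL, ha⟩ := Finset.exists_mem_notMem_of_card_lt_card
    ((Finset.card_image_le (f := c)).trans_lt he)
  have hne : ∀ f ∈ S, f ≠ e := fun f hf h => heS (h ▸ hf)
  have ha' : ∀ f ∈ S, G.EdgeConflict e f → c f ≠ a := fun f hf hef h =>
    ha (Finset.mem_image.2 ⟨f, by simp [hf, hne f hf, hef], h⟩)
  refine ⟨Function.update c e a, fun f hf => ?_, fun f hf g hg hfg hconf => ?_⟩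
  · rcases Finset.mem_insert.1 hf with rfl | hf
    · simpa using haL
    · simpa [Function.update_of_ne (hne f hf)] using hcL f hf
  · rcases Finset.mem_insert.1 hf with hf' | hf' <;> rcases Finset.mem_insert.1 hg with hg' | hg'
    · exact absurd (hf'.trans hg'.symm) hfg
    · subst hf'
      rw [Function.update_self, Function.update_of_ne (hne g hg')]
      exact (ha' g hg' hconf).symm
    · subst hg'
      rw [Function.update_self, Function.update_of_ne (hne f hf')]
      exact ha' f hf' hconf.symm
    · rw [Function.update_of_ne (hne f hf'), Function.update_of_ne (hne g hg')]
      exact hc f hf' g hg' hfg hconf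

/-- Conflicts are counted in all of `T`, so the new edges can be colored greedily in any order. -/
theorem ListColorableOn.extend {L : Sym2 V → Finset ℕ} {S T : Finset (Sym2 V)}
    (h : G.ListColorableOn L S) (hST : S ⊆ T)
    (hT : ∀ e ∈ T \ S, #{f ∈ T | f ≠ e ∧ G.EdgeConflict e f} < #(L e)) :
    G.ListColorableOn L T := by
  have key : ∀ R ⊆ T \ S, G.ListColorableOn L (R ∪ S) := by
    intro R
    induction R using Finset.induction_on with
    | empty => simpa using h
    | insert e R _ ih =>
      intro hR
      rw [Finset.insert_union]
      have hRT : R ⊆ T \ S := fun x hx => hR (Finset.mem_insert_of_mem hx)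
      refine (ih hRT).insert (lt_of_le_of_lt ?_ (hT e (hR (Finset.mem_insert_self _ _))))
      refine Finset.card_le_card (Finset.filter_subset_filter _ ?_)
      exact Finset.union_subset (hRT.trans Finset.sdiff_subset) hST
  simpa [Finset.sdiff_union_of_subset hST] using key _ subset_rfl

theorem sum_le_of_card_filter_le {s : Finset V} {f : V → ℕ} {p : V → Prop} {k j n m : ℕ}
    (hs : #s ≤ m) (hkn : k ≤ n) (hf : ∀ y ∈ s, f y ≤ n) (hp : ∀ y ∈ s, ¬ p y → f y ≤ k)
    (hj : #{y ∈ s | p y} ≤ j) : ∑ y ∈ s, f y ≤ m * k + j * (n - k) := by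
  calc ∑ y ∈ s, f y ≤ ∑ y ∈ s, (k + if p y then n - k else 0) := by
        refine Finset.sum_le_sum fun y hy => ?_
        split_ifs with h
        · have := hf y hy; omega
        · exact hp y hy h
    _ = #s * k + #{y ∈ s | p y} * (n - k) := by
        rw [Finset.sum_add_distrib, ← Finset.sum_filter]; simp
    _ ≤ _ := add_le_add (Nat.mul_le_mul_right _ hs) (Nat.mul_le_mul_right _ hj)

/-- Delete the edges that join `v` to a neighbor satisfying `P`. -/
def deleteEdgesAt (H : SimpleGraph V) (v : V) (P : V → Prop) : SimpleGraph V where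
  Adj x y := H.Adj x y ∧ ¬ (x = v ∧ P y) ∧ ¬ (y = v ∧ P x)
  symm := ⟨fun _ _ h => ⟨h.1.symm, h.2.2, h.2.1⟩⟩
  loopless := ⟨fun _ h => h.1.ne rfl⟩

theorem deleteEdgesAt_le (v : V) (P : V → Prop) : H.deleteEdgesAt v P ≤ H := fun _ _ h => h.1

theorem StrongEdgeChoosable.strongEdgeColorable {n : ℕ} (h : G.StrongEdgeChoosable n) :
    G.StrongEdgeColorable n := by
  obtain ⟨c, hc, hcL⟩ := h (fun _ => Finset.range n) (by simp)
  refine ⟨fun e => ⟨c e, by simpa using hcL e⟩, fun a e he f hf => ?_⟩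
  exact hc a e (congrArg Fin.val he) f (congrArg Fin.val hf)

/-! ### Reducible edges and conflict counts -/

variable [Fintype V]

/-- A chordless graph with an edge has an edge `vu` such that either `u` is a leaf and `v` has at
most two neighbors that are not leaves, or `u` has degree at most two and `v` has at most one
neighbor of degree at least three. -/
theorem IsChordlessGraph.exists_reducible_edge (hG : G.IsChordlessGraph) {a b : V}
    (hab : G.Adj a b) :
    (∃ v u, G.Adj v u ∧ G.degree u = 1 ∧ #{x ∈ G.neighborFinset v | 2 ≤ G.degree x} ≤ 2) ∨
    ∃ v u, G.Adj v u ∧ G.degree u ≤ 2 ∧ #{x ∈ G.neighborFinset v | 3 ≤ G.degree x} ≤ 1 := by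
  by_contra! hcon
  obtain ⟨hleaf, hcon⟩ := hcon
  have hpos : ∀ {x y}, G.Adj x y → 0 < G.degree x := fun h =>
    (G.degree_pos_iff_exists_adj _).2 ⟨_, h⟩
  -- `K` discards the leaves. As the first alternative fails, a non-leaf either keeps its degree or
  -- has degree at least 3 in `K`, so a low-degree vertex of `K` is one of `G`.
  obtain ⟨K, hKadj⟩ : ∃ K : SimpleGraph V,
      ∀ x y, K.Adj x y ↔ G.Adj x y ∧ 2 ≤ G.degree x ∧ 2 ≤ G.degree y :=
    ⟨{ Adj := fun x y => G.Adj x y ∧ 2 ≤ G.degree x ∧ 2 ≤ G.degree y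
       symm := ⟨fun x y h => ⟨h.1.symm, h.2.2, h.2.1⟩⟩
       loopless := ⟨fun x h => h.1.ne rfl⟩ }, fun _ _ => Iff.rfl⟩
  have hKG : K ≤ G := fun x y h => ((hKadj x y).1 h).1
  have hKN : ∀ v, 2 ≤ G.degree v →
      K.neighborFinset v = {x ∈ G.neighborFinset v | 2 ≤ G.degree x} := by
    intro v hv
    ext x
    simp [hKadj, hv]
  have hdeg : ∀ v, 2 ≤ G.degree v → 3 ≤ K.degree v ∨ K.degree v = G.degree v := by
    intro v hv
    rw [← card_neighborFinset_eq_degree, hKN v hv]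
    by_cases h : ∃ u, G.Adj v u ∧ G.degree u = 1
    · obtain ⟨u, hu, hu1⟩ := h
      exact .inl (hleaf v u hu hu1)
    · right
      rw [← card_neighborFinset_eq_degree, Finset.filter_true_of_mem]
      intro x hx
      rw [mem_neighborFinset] at hx
      have := hpos hx.symm
      have : G.degree x ≠ 1 := fun h' => h ⟨x, hx, h'⟩
      omega
  have hK : ∃ x y, K.Adj x y := by
    have aux : ∀ x y, G.Adj x y → G.degree x = 1 → ∃ x y, K.Adj x y := by
      intro x y hxy hx
      have h := hleaf y x hxy.symm hx
      have hy : 2 ≤ G.degree y := by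
        rw [← card_neighborFinset_eq_degree]
        exact h.le.trans (Finset.card_filter_le _ _)
      obtain ⟨z, hz⟩ := Finset.card_pos.1 (Nat.zero_lt_of_lt h)
      simp only [Finset.mem_filter, mem_neighborFinset] at hz
      exact ⟨y, z, (hKadj y z).2 ⟨hz.1, hy, hz.2⟩⟩
    by_cases ha : G.degree a = 1
    · exact aux a b hab ha
    by_cases hb : G.degree b = 1
    · exact aux b a hab.symm hb
    have := hpos hab
    have := hpos hab.symm
    exact ⟨a, b, (hKadj a b).2 ⟨hab, by omega, by omega⟩⟩
  obtain ⟨x, y, hxy⟩ := hK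
  obtain ⟨v, w, hvw, hv⟩ := (hG.mono hKG).exists_card_neighborFinset_filter_le_one hxy
  obtain ⟨-, hv2', -⟩ := (hKadj v w).1 hvw
  have hv2 : 2 ≤ K.degree v := by
    have := hdeg v hv2'
    omega
  obtain ⟨u, hu, hu3⟩ : ∃ u ∈ K.neighborFinset v, ¬ 3 ≤ K.degree u := by
    by_contra! h
    rw [Finset.filter_true_of_mem h, card_neighborFinset_eq_degree] at hv
    omega
  rw [mem_neighborFinset, hKadj] at hu
  have hu2 := hdeg u hu.2.2
  have h1 := hcon v u hu.1 (by omega)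
  have h2 : #{x ∈ G.neighborFinset v | 3 ≤ G.degree x} ≤
      #{x ∈ K.neighborFinset v | 3 ≤ K.degree x} := by
    refine Finset.card_le_card fun z hz => ?_
    simp only [Finset.mem_filter, mem_neighborFinset] at hz ⊢
    have := hdeg z (by omega)
    exact ⟨(hKadj v z).2 ⟨hz.1, hv2', by omega⟩, by omega⟩
  omega

/-- Every conflicting edge has an end adjacent in `G` to `v` or `u`, other than `u` or `v`
respectively. -/
theorem card_edgeConflict_le (hHG : H ≤ G) {v u : V} :
    #{f ∈ H.edgeFinset | f ≠ s(v, u) ∧ G.EdgeConflict s(v, u) f} ≤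
      ∑ y ∈ (G.neighborFinset v).erase u, H.degree y +
        ∑ y ∈ (G.neighborFinset u).erase v, H.degree y := by
  have hsub : {f ∈ H.edgeFinset | f ≠ s(v, u) ∧ G.EdgeConflict s(v, u) f} ⊆
      ((G.neighborFinset v).erase u).biUnion (fun y => H.incidenceFinset y) ∪
        ((G.neighborFinset u).erase v).biUnion (fun y => H.incidenceFinset y) := by
    intro f hf
    simp only [Finset.mem_filter, mem_edgeFinset] at hf
    obtain ⟨hfH, hne, x, hx, z, hz, hxz⟩ := hf
    simp only [Finset.mem_union, Finset.mem_biUnion, Finset.mem_erase, mem_neighborFinset,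
      mem_incidenceFinset, incidenceSet, Set.mem_sep_iff]
    have key : ∀ v u, f ≠ s(v, u) → v ∈ f → ∃ y, (y ≠ u ∧ G.Adj v y) ∧ f ∈ H.edgeSet ∧ y ∈ f := by
      intro v u hne hv
      obtain ⟨y, rfl⟩ := Sym2.mem_iff_exists.1 hv
      exact ⟨y, ⟨fun h => hne (by rw [h]), hHG hfH⟩, hfH, by simp⟩
    have hne' : f ≠ s(u, v) := by rwa [Sym2.eq_swap]
    rcases Sym2.mem_iff.1 hx with rfl | rfl <;> rcases hxz with rfl | hxz
    · exact .inl (key _ _ hne hz)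
    · by_cases h : z = u
      · exact .inr (key _ _ hne' (h ▸ hz))
      · exact .inl ⟨z, ⟨h, hxz⟩, hfH, hz⟩
    · exact .inr (key _ _ hne' hz)
    · by_cases h : z = v
      · exact .inl (key _ _ hne (h ▸ hz))
      · exact .inr ⟨z, ⟨h, hxz⟩, hfH, hz⟩
  refine (Finset.card_le_card hsub).trans ((Finset.card_union_le _ _).trans ?_)
  refine add_le_add (Finset.card_biUnion_le.trans_eq ?_) (Finset.card_biUnion_le.trans_eq ?_) <;>
  simp

/-- Around `v`, at most two vertices contribute up to n and the others at most 1; around `u`, all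
contribute at most 1 by `hinv`. This gives 3(n - 1) + (n - 1). -/
theorem card_edgeConflict_le_of_degree_eq_one {n : ℕ} (hHG : H ≤ G)
    (hn : ∀ v, G.degree v ≤ n)
    (hinv : ∀ a b, G.Adj a b → ¬ H.Adj a b → H.degree a * H.degree b ≤ 1) {v u : V}
    (hvu : H.Adj v u) (hu : H.degree u = 1)
    (hv : #{x ∈ H.neighborFinset v | 2 ≤ H.degree x} ≤ 2) :
    #{f ∈ H.edgeFinset | f ≠ s(v, u) ∧ G.EdgeConflict s(v, u) f} ≤ 4 * n - 4 := by
  have hHn : ∀ v, H.degree v ≤ n := fun v => (degree_le_of_le hHG).trans (hn v)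
  have hn1 : 1 ≤ n := hu ▸ hHn u
  have hv1 : 0 < H.degree v := (H.degree_pos_iff_exists_adj v).2 ⟨u, hvu⟩
  have h1 : ∑ y ∈ (G.neighborFinset v).erase u, H.degree y ≤ (n - 1) * 1 + 2 * (n - 1) := by
    refine sum_le_of_card_filter_le (p := fun y => H.Adj v y ∧ 2 ≤ H.degree y) ?_ hn1
      (fun y _ => hHn y) ?_ ?_
    · rw [Finset.card_erase_of_mem (by simpa using hHG hvu), card_neighborFinset_eq_degree]
      exact Nat.sub_le_sub_right (hn v) 1
    · intro y hy hp
      by_cases h : H.Adj v y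
      · have := not_and.1 hp h; omega
      · have := hinv v y (by simpa using Finset.mem_of_mem_erase hy) h
        nlinarith
    · refine (Finset.card_le_card fun y hy => ?_).trans hv
      simp only [Finset.mem_filter, mem_neighborFinset] at hy ⊢
      exact hy.2
  have h2 : ∑ y ∈ (G.neighborFinset u).erase v, H.degree y ≤ (n - 1) * 1 + 0 * (n - 1) := by
    refine sum_le_of_card_filter_le (p := fun _ => False) ?_ hn1 (fun y _ => hHn y) ?_ (by simp)
    · rw [Finset.card_erase_of_mem (by simpa using hHG hvu.symm), card_neighborFinset_eq_degree]
      exact Nat.sub_le_sub_right (hn u) 1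
    · intro y hy _
      have hy' : y ≠ v ∧ G.Adj u y := by simpa using hy
      have h : ¬ H.Adj u y := by
        intro h
        rw [← card_neighborFinset_eq_degree, Finset.card_eq_one] at hu
        obtain ⟨x, hx⟩ := hu
        have h3 : y ∈ H.neighborFinset u := by simpa using h
        have h4 : v ∈ H.neighborFinset u := by simpa using hvu.symm
        rw [hx, Finset.mem_singleton] at h3 h4
        exact hy'.1 (h3.trans h4.symm)
      have := hinv u y hy'.2 h
      rw [hu] at this
      omega
  have := card_edgeConflict_le hHG (v := v) (u := u)
  omega

/-- Around `v`, one vertex contributes up to n and the others at most 2, in all 2(n - 1) + (n - 2).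
Around `u` the total is at most n: a second H-neighbor makes the other contributions 0 by `hinv`;
without one, each is at most 1. -/
theorem card_edgeConflict_le_of_degree_le_two {n : ℕ} (hHG : H ≤ G)
    (hn : ∀ v, G.degree v ≤ n)
    (hinv : ∀ a b, G.Adj a b → ¬ H.Adj a b → H.degree a * H.degree b ≤ 1) {v u : V}
    (hvu : H.Adj v u) (hu : H.degree u ≤ 2)
    (hv : #{x ∈ H.neighborFinset v | 3 ≤ H.degree x} ≤ 1) :
    #{f ∈ H.edgeFinset | f ≠ s(v, u) ∧ G.EdgeConflict s(v, u) f} ≤ 4 * n - 4 := by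
  have hHn : ∀ v, H.degree v ≤ n := fun v => (degree_le_of_le hHG).trans (hn v)
  have hv1 : 0 < H.degree v := (H.degree_pos_iff_exists_adj v).2 ⟨u, hvu⟩
  have hu1 : 0 < H.degree u := (H.degree_pos_iff_exists_adj u).2 ⟨v, hvu.symm⟩
  have hcv : #((G.neighborFinset v).erase u) ≤ n - 1 := by
    rw [Finset.card_erase_of_mem (by simpa using hHG hvu), card_neighborFinset_eq_degree]
    exact Nat.sub_le_sub_right (hn v) 1
  have hcu : #((G.neighborFinset u).erase v) ≤ n - 1 := by
    rw [Finset.card_erase_of_mem (by simpa using hHG hvu.symm), card_neighborFinset_eq_degree]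
    exact Nat.sub_le_sub_right (hn u) 1
  have hle := card_edgeConflict_le hHG (v := v) (u := u)
  -- The bound 2 for ordinary vertices needs `2 ≤ n`; for smaller n both sums are empty.
  rcases Nat.lt_or_ge n 2 with hn2 | hn2
  · have h1 : (G.neighborFinset v).erase u = ∅ := Finset.card_eq_zero.1 (by omega)
    have h2 : (G.neighborFinset u).erase v = ∅ := Finset.card_eq_zero.1 (by omega)
    rw [h1, h2] at hle
    simp only [Finset.sum_empty, add_zero] at hle
    omega
  have h1 : ∑ y ∈ (G.neighborFinset v).erase u, H.degree y ≤ (n - 1) * 2 + 1 * (n - 2) := by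
    refine sum_le_of_card_filter_le (p := fun y => H.Adj v y ∧ 3 ≤ H.degree y) hcv hn2
      (fun y _ => hHn y) ?_ ?_
    · intro y hy hp
      by_cases h : H.Adj v y
      · have := not_and.1 hp h; omega
      · have := hinv v y (by simpa using Finset.mem_of_mem_erase hy) h
        nlinarith
    · refine (Finset.card_le_card fun y hy => ?_).trans hv
      simp only [Finset.mem_filter, mem_neighborFinset] at hy ⊢
      exact hy.2
  have h2 : ∑ y ∈ (G.neighborFinset u).erase v, H.degree y ≤ n := by
    have hcard : #{y ∈ (G.neighborFinset u).erase v | H.Adj u y} ≤ H.degree u - 1 := by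
      rw [← card_neighborFinset_eq_degree,
        ← Finset.card_erase_of_mem (a := v) (by simpa using hvu.symm)]
      refine Finset.card_le_card fun y hy => ?_
      simp only [Finset.mem_filter, Finset.mem_erase, mem_neighborFinset] at hy ⊢
      exact ⟨hy.1.1, hy.2⟩
    have hinv' : ∀ y ∈ (G.neighborFinset u).erase v, ¬ H.Adj u y →
        H.degree u * H.degree y ≤ 1 := fun y hy h =>
      hinv u y (by simpa using Finset.mem_of_mem_erase hy) h
    rcases Nat.lt_or_ge (H.degree u) 2 with hu2 | hu2
    · have hu' : H.degree u = 1 := by omega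
      rw [hu'] at hcard hinv'
      have := sum_le_of_card_filter_le hcu (by omega : 1 ≤ n) (fun y _ => hHn y)
        (fun y hy h => (one_mul (H.degree y)) ▸ hinv' y hy h) hcard
      omega
    · have hu' : H.degree u = 2 := by omega
      rw [hu'] at hcard hinv'
      have := sum_le_of_card_filter_le hcu (by omega : 0 ≤ n) (fun y _ => hHn y)
        (fun y hy h => by have := hinv' y hy h; omega) hcard
      omega
  omega

theorem degree_deleteEdgesAt_lt {v u : V} {P : V → Prop} (hvu : H.Adj v u) (hu : P u) :
    (H.deleteEdgesAt v P).degree u < H.degree u := by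
  rw [← card_neighborFinset_eq_degree, ← card_neighborFinset_eq_degree]
  refine Finset.card_lt_card (Finset.ssubset_iff_of_subset ?_ |>.2 ⟨v, ?_, ?_⟩)
  · intro x hx
    rw [mem_neighborFinset] at hx ⊢
    exact hx.1
  · simpa using hvu.symm
  · rw [mem_neighborFinset]
    exact fun h => h.2.2 ⟨rfl, hu⟩

theorem degree_deleteEdgesAt_le (v : V) (P : V → Prop) :
    (H.deleteEdgesAt v P).degree v ≤ #{x ∈ H.neighborFinset v | ¬ P x} := by
  rw [← card_neighborFinset_eq_degree]
  refine Finset.card_le_card fun x hx => ?_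
  rw [mem_neighborFinset] at hx
  simp only [Finset.mem_filter, mem_neighborFinset]
  exact ⟨hx.1, fun h => hx.2.1 ⟨rfl, h⟩⟩

theorem IsChordlessGraph.listColorableOn (hG : G.IsChordlessGraph) {n : ℕ}
    (hn : ∀ v, G.degree v ≤ n) {L : Sym2 V → Finset ℕ}
    (hL : ∀ e ∈ G.edgeSet, 4 * n - 3 ≤ #(L e)) (H : SimpleGraph V) (hHG : H ≤ G)
    (hinv : ∀ a b, G.Adj a b → ¬ H.Adj a b → H.degree a * H.degree b ≤ 1) :
    G.ListColorableOn L H.edgeFinset := by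
  induction H using WellFoundedLT.induction with
  | ind H ih =>
  by_cases hE : ∃ a b, H.Adj a b
  swap
  · have : H = ⊥ := by
      ext a b
      simpa using fun h => hE ⟨a, b, h⟩
    subst this
    exact ⟨fun _ => 0, by simp, by simp⟩
  -- Color the rest first, then the deleted edges; the product condition restores the invariant.
  have key : ∀ (v u : V) (P : V → Prop), H.Adj v u → P u →
      (∀ w, H.Adj v w → P w →
        #{f ∈ H.edgeFinset | f ≠ s(v, w) ∧ G.EdgeConflict s(v, w) f} ≤ 4 * n - 4 ∧
        (H.deleteEdgesAt v P).degree v * (H.deleteEdgesAt v P).degree w ≤ 1) →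
      G.ListColorableOn L H.edgeFinset := by
    intro v u P hvu hPu hP
    have hn1 : 1 ≤ n := ((G.degree_pos_iff_exists_adj v).2 ⟨u, hHG hvu⟩).trans_le (hn v)
    have hle := H.deleteEdgesAt_le v P
    refine (ih _ (lt_of_le_of_ne hle ?_) (hle.trans hHG) ?_).extend ?_ ?_
    · intro h
      have : (H.deleteEdgesAt v P).Adj v u := h.ge hvu
      exact this.2.1 ⟨rfl, hPu⟩
    · intro a b hab hab'
      by_cases hH : H.Adj a b
      · by_cases h : a = v ∧ P b
        · obtain ⟨rfl, hb⟩ := h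
          exact (hP b hH hb).2
        · by_cases h' : b = v ∧ P a
          · obtain ⟨rfl, ha⟩ := h'
            rw [mul_comm]
            exact (hP a hH.symm ha).2
          · exact absurd ⟨hH, h, h'⟩ hab'
      · exact (Nat.mul_le_mul (degree_le_of_le hle) (degree_le_of_le hle)).trans
          (hinv a b hab hH)
    · exact edgeFinset_subset_edgeFinset.2 hle
    · intro e he
      rw [Finset.mem_sdiff, mem_edgeFinset, mem_edgeFinset] at he
      have : ∃ w, H.Adj v w ∧ P w ∧ e = s(v, w) := by
        induction e with
        | h a b =>
          simp only [mem_edgeSet] at he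
          by_cases h : a = v ∧ P b
          · exact ⟨b, h.1 ▸ he.1, h.2, by rw [h.1]⟩
          · by_cases h' : b = v ∧ P a
            · exact ⟨a, h'.1 ▸ he.1.symm, h'.2, by rw [h'.1, Sym2.eq_swap]⟩
            · exact absurd ⟨he.1, h, h'⟩ he.2
      obtain ⟨w, hvw, hPw, rfl⟩ := this
      have h1 := (hP w hvw hPw).1
      have h2 := hL s(v, w) (hHG hvw)
      omega
  obtain ⟨a, b, hab⟩ := hE
  rcases (hG.mono hHG).exists_reducible_edge hab with ⟨v, u, hvu, hu, hv⟩ | ⟨v, u, hvu, hu, hv⟩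
  · refine key v u (· = u) hvu rfl fun w hvw hw => ?_
    subst hw
    refine ⟨card_edgeConflict_le_of_degree_eq_one hHG hn hinv hvu hu hv, ?_⟩
    have := degree_deleteEdgesAt_lt (P := (· = w)) hvw rfl
    rw [hu, Nat.lt_one_iff] at this
    rw [this]
    simp
  -- All such edges at `v` go at once: this leaves `v` and each detached neighbor with degree at
  -- most 1.
  · refine key v u (H.degree · ≤ 2) hvu hu fun w hvw hw => ?_
    refine ⟨card_edgeConflict_le_of_degree_le_two hHG hn hinv hvw hw hv, ?_⟩
    have h1 := degree_deleteEdgesAt_lt (P := (H.degree · ≤ 2)) hvw hw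
    have h2 := degree_deleteEdgesAt_le (H := H) v (H.degree · ≤ 2)
    simp only [not_le] at h2
    exact Nat.mul_le_mul (h2.trans hv) (by omega : _ ≤ 1)

theorem IsChordlessGraph.strongEdgeChoosable (hG : G.IsChordlessGraph) {n : ℕ}
    (hn : ∀ v, G.degree v ≤ n) : G.StrongEdgeChoosable (4 * n - 3) := by
  intro L hL
  obtain ⟨c, hcL, hc⟩ := hG.listColorableOn hn
    (L := fun e => if h : e ∈ G.edgeSet then L ⟨e, h⟩ else ∅)
    (fun e he => by simpa [he] using hL ⟨e, he⟩) G le_rfl (fun a b h h' => absurd h h')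
  refine ⟨fun e => c e, ?_, fun e => by simpa using hcL e (by simp)⟩
  intro a e he f hf hef u hu v hv
  have h : ¬ G.EdgeConflict e f := fun h =>
    hc e (by simp) f (by simp) (fun h => hef (Subtype.ext h)) h (he.trans hf.symm)
  exact ⟨fun huv => h ⟨u, hu, v, hv, .inl huv⟩, fun huv => h ⟨u, hu, v, hv, .inr huv⟩⟩

end ListColoring

end SimpleGraph

theorem theorem4 {V : Type*} [Fintype V] (G : SimpleGraph V) [DecidableRel G.Adj]
    (hG : G.IsChordlessGraph) (hE : G.edgeSet.Nonempty) :
    G.strongChromaticIndex ≤ ((4 * G.maxDegree - 3 : ℕ) : ℕ∞) ∧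
      G.listStrongChromaticIndex ≤ ((4 * G.maxDegree - 3 : ℕ) : ℕ∞) := by
  have h : G.StrongEdgeChoosable (4 * G.maxDegree - 3) :=
    hG.strongEdgeChoosable fun v => by convert G.degree_le_maxDegree v
  exact ⟨iInf₂_le _ h.strongEdgeColorable, iInf₂_le _ h⟩
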